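/- Let $(x_\alpha)_{\alpha\in\mathbb Z}$ and $(y_\alpha)_{\alpha\in\mathbb Z}$ be two families of real random variables on a probability space $(\Omega,\mathbb P)$ such that the variables within each family are independent and the two families are independent of each other. Assume that every $x_\alpha$ and every $y_\alpha$ has mean zero and variance one, and that for every $p\in\mathbb N$, $$\sup_{\alpha\in\mathbb Z}\mathbb E|x_\alpha|^p<\infty\quad\text{and}\quad \sup_{\alpha\in\mathbb Z}\mathbb E|y_\alpha|^p<\infty .$$ (For example, each family may be i.i.d. with zero mean, unit variance and all moments finite.) For $n\ge 1$ let $X_n=(x_{|i-j|})_{1\le i,j\le n}$ be the symmetric Toeplitz matrix and $Y_n=(y_{i+j})_{1\le i,j\le n}$ the Hankel matrix built from these variables, and let $M_n=X_n\odot Y_n$ be their entrywise (Schur-Hadamard) product. Then for every integer $k\ge 0$ the entries of $(n^{-1/2}M_n)^k$ are integrable, and the $k$-th moment of $n^{-1/2}M_n$ with respect to the state $\frac1n\mathbb E\,\mathrm{tr}$ converges to the $k$-th moment of a semicircular variable: $$\lim_{n\to\infty}\frac1n\,\mathbb E\,\mathrm{tr}\Big[\big(n^{-1/2}M_n\big)^k\Big]=\begin{cases}C_{k/2}&\text{if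 }k\text{ is even},\\[2pt] 0&\text{if }k\text{ is odd},\end{cases}\qquad C_m=\frac1{m+1}\binom{2m}{m}.$$ -/

import Mathlib

open MeasureTheory ProbabilityTheory Filter Topology
open scoped Matrix

noncomputable section

/-- Standing assumptions on one input sequence of (real) random variables: independence, zero mean,
unit variance, and, for each order `p`, a bound on the absolute moments of order `p` which is
uniform in the index. The variables need not be identically distributed. -/
structure IsInputSequence {Ω : Type*} [MeasurableSpace Ω] (μ : Measure Ω) (x : ℤ → Ω → ℝ) :
    Prop where
  measurable : ∀ α, Measurable (x α)
  indep : iIndepFun x μ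
  memLp : ∀ α, ∀ p : ℕ, MemLp (x α) (p : ENNReal) μ
  mean_zero : ∀ α, ∫ ω, x α ω ∂μ = 0
  unit_variance : ∀ α, variance (x α) μ = 1
  moment_bound : ∀ p : ℕ, ∃ C : ℝ, ∀ α, ∫ ω, |x α ω| ^ p ∂μ ≤ C

/-- The `n × n` patterned matrix `(x_{L(i,j)})_{1 ≤ i, j ≤ n}`; rows and columns are indexed by
`Fin n`, so that the index `i : Fin n` stands for `i + 1 ∈ {1, …, n}`. -/
def patternedMatrix {Ω : Type*} (L : ℕ → ℕ → ℤ) (x : ℤ → Ω → ℝ) (n : ℕ) (ω : Ω) :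
    Matrix (Fin n) (Fin n) ℝ :=
  Matrix.of fun i j => x (L ((i : ℕ) + 1) ((j : ℕ) + 1)) ω

/-- The symmetric Toeplitz link function `L(i,j) = |i - j|`. -/
def symmToeplitzLink (i j : ℕ) : ℤ := |(i : ℤ) - (j : ℤ)|

/-- The Hankel link function `L(i,j) = i + j`. -/
def hankelLink (i j : ℕ) : ℤ := (i : ℤ) + (j : ℤ)

/-- The random matrix `M_n = X_n ⊙ Y_n` (Schur-Hadamard product) scaled by `n^{-1/2}`. -/
def scaledSchurProduct {Ω : Type*} (LX LY : ℕ → ℕ → ℤ) (x y : ℤ → Ω → ℝ) (n : ℕ) (ω : Ω) :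
    Matrix (Fin n) (Fin n) ℝ :=
  (Real.sqrt (n : ℝ))⁻¹ • (patternedMatrix LX x n ω ⊙ patternedMatrix LY y n ω)

/-- The state `(1/n) 𝔼 tr` on random `n × n` matrices. -/
def expectedNormalizedTrace {Ω : Type*} [MeasurableSpace Ω] (μ : Measure Ω) {n : ℕ}
    (A : Ω → Matrix (Fin n) (Fin n) ℝ) : ℝ :=
  (1 / (n : ℝ)) * ∫ ω, (A ω).trace ∂μ

/-- The `k`-th moment of a semicircular variable: the Catalan number `C_{k/2}` for even `k`, and
`0` for odd `k`. -/
def semicircularMoment (k : ℕ) : ℝ := if Even k then (catalan (k / 2) : ℝ) else 0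

end

/-! ### Repetitions in a finite sequence -/

/-- Every value among the first `k` terms of `f` is attained at least twice there. -/
def Matched (k : ℕ) (f : ℕ → ℤ) : Prop := ∀ t < k, ∃ s < k, s ≠ t ∧ f s = f t

open scoped Classical in
/-- The indices below `k` at which `f` takes a new value. -/
noncomputable def firsts (k : ℕ) (f : ℕ → ℤ) : Finset ℕ :=
  (Finset.range k).filter fun t => ∀ s < t, f s ≠ f t

/-- The indices below `k` at which `f` takes the value `v`. -/
def fiber (k : ℕ) (f : ℕ → ℤ) (v : ℤ) : Finset ℕ := (Finset.range k).filter fun t => f t = v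

lemma mem_firsts {k : ℕ} {f : ℕ → ℤ} {t : ℕ} :
    t ∈ firsts k f ↔ t < k ∧ ∀ s < t, f s ≠ f t := by
  simp [firsts]

lemma mem_fiber {k : ℕ} {f : ℕ → ℤ} {v : ℤ} {t : ℕ} : t ∈ fiber k f v ↔ t < k ∧ f t = v := by
  simp [fiber]

lemma exists_mem_firsts {k : ℕ} (f : ℕ → ℤ) {t : ℕ} (ht : t < k) :
    ∃ s ∈ firsts k f, s ≤ t ∧ f s = f t := by
  induction t using Nat.strong_induction_on with
  | _ t ih =>
    by_cases h : ∀ s < t, f s ≠ f t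
    · exact ⟨t, mem_firsts.2 ⟨ht, h⟩, le_rfl, rfl⟩
    · push Not at h
      obtain ⟨s, hs, hst⟩ := h
      obtain ⟨r, hr, hrs, hf⟩ := ih s hs (hs.trans ht)
      exact ⟨r, hr, hrs.trans hs.le, hf.trans hst⟩

lemma injOn_firsts (k : ℕ) (f : ℕ → ℤ) : Set.InjOn f (firsts k f) := by
  intro a ha b hb hab
  rcases lt_trichotomy a b with h | h | h
  · exact absurd hab ((mem_firsts.1 hb).2 a h)
  · exact h
  · exact absurd hab.symm ((mem_firsts.1 ha).2 b h)

lemma image_firsts (k : ℕ) (f : ℕ → ℤ) :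
    (firsts k f).image f = (Finset.range k).image f := by
  ext v
  simp only [Finset.mem_image, Finset.mem_range]
  constructor
  · rintro ⟨s, hs, rfl⟩
    exact ⟨s, (mem_firsts.1 hs).1, rfl⟩
  · rintro ⟨t, ht, rfl⟩
    obtain ⟨s, hs, -, h⟩ := exists_mem_firsts f ht
    exact ⟨s, hs, h⟩

lemma card_firsts (k : ℕ) (f : ℕ → ℤ) :
    (firsts k f).card = ((Finset.range k).image f).card := by
  rw [← image_firsts, Finset.card_image_of_injOn (injOn_firsts k f)]

lemma sum_card_fiber (k : ℕ) (f : ℕ → ℤ) :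
    ∑ v ∈ (Finset.range k).image f, (fiber k f v).card = k := by
  have h := Finset.card_eq_sum_card_fiberwise (f := f) (s := Finset.range k)
    (t := (Finset.range k).image f) (fun t ht => Finset.mem_image_of_mem f ht)
  rw [Finset.card_range] at h
  exact h.symm

lemma Matched.two_le_card_fiber {k : ℕ} {f : ℕ → ℤ} (h : Matched k f) {v : ℤ}
    (hv : v ∈ (Finset.range k).image f) : 2 ≤ (fiber k f v).card := by
  obtain ⟨t, ht, rfl⟩ := Finset.mem_image.1 hv
  obtain ⟨s, hs, hst, hf⟩ := h t (Finset.mem_range.1 ht)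
  exact Finset.one_lt_card.2 ⟨s, mem_fiber.2 ⟨hs, hf⟩, t,
    mem_fiber.2 ⟨Finset.mem_range.1 ht, rfl⟩, hst⟩

lemma Matched.two_mul_card_firsts_le {k : ℕ} {f : ℕ → ℤ} (h : Matched k f) :
    2 * (firsts k f).card ≤ k := by
  calc 2 * (firsts k f).card = ∑ v ∈ (Finset.range k).image f, 2 := by
        rw [card_firsts]; simp [mul_comm]
    _ ≤ ∑ v ∈ (Finset.range k).image f, (fiber k f v).card :=
        Finset.sum_le_sum fun v hv => h.two_le_card_fiber hv
    _ = k := sum_card_fiber k f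

lemma Matched.card_fiber_eq_two {k : ℕ} {f : ℕ → ℤ} (h : Matched k f)
    (hk : 2 * (firsts k f).card = k) {v : ℤ} (hv : v ∈ (Finset.range k).image f) :
    (fiber k f v).card = 2 := by
  have key : ∑ v ∈ (Finset.range k).image f, 2 =
      ∑ v ∈ (Finset.range k).image f, (fiber k f v).card := by
    rw [sum_card_fiber, Finset.sum_const, smul_eq_mul, ← card_firsts, mul_comm, hk]
  exact ((Finset.sum_eq_sum_iff_of_le fun v hv => h.two_le_card_fiber hv).1 key v hv).symm

/-! ### Moments of products of independent variables -/

section Moments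

variable {Ω : Type*} [MeasurableSpace Ω] {μ : Measure Ω} {x y : ℤ → Ω → ℝ}

lemma abs_prod_le_one_add_sum_pow (k : ℕ) (z : ℕ → ℝ) :
    |∏ t ∈ Finset.range k, z t| ≤ 1 + ∑ t ∈ Finset.range k, |z t| ^ k := by
  rcases Nat.eq_zero_or_pos k with rfl | hk
  · simp
  obtain ⟨m, hm, hmax⟩ := Finset.exists_max_image (Finset.range k) (fun t => |z t|)
    ⟨0, Finset.mem_range.2 hk⟩
  calc |∏ t ∈ Finset.range k, z t| = ∏ t ∈ Finset.range k, |z t| := Finset.abs_prod _ _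
    _ ≤ ∏ t ∈ Finset.range k, |z m| :=
        Finset.prod_le_prod (fun _ _ => abs_nonneg _) fun t ht => hmax t ht
    _ = |z m| ^ k := by simp
    _ ≤ ∑ t ∈ Finset.range k, |z t| ^ k :=
        Finset.single_le_sum (f := fun t => |z t| ^ k) (fun _ _ => by positivity) hm
    _ ≤ _ := by linarith

lemma IsInputSequence.integrable_abs_pow [IsProbabilityMeasure μ] (hx : IsInputSequence μ x) (α : ℤ) (p : ℕ) :
    Integrable (fun ω => |x α ω| ^ p) μ :=
  (hx.memLp α p).integrable_norm_pow'

lemma measurable_prod_apply (k : ℕ) (f : ℕ → ℤ) :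
    Measurable (fun z : ℤ → ℝ => ∏ t ∈ Finset.range k, z (f t)) :=
  Finset.measurable_fun_prod _ fun t _ => measurable_pi_apply (f t)

lemma IsInputSequence.integrable_prod [IsProbabilityMeasure μ] (hx : IsInputSequence μ x) (k : ℕ)
    (f : ℕ → ℤ) : Integrable (fun ω => ∏ t ∈ Finset.range k, x (f t) ω) μ := by
  have hm : Measurable (fun ω => ∏ t ∈ Finset.range k, x (f t) ω) :=
    Finset.measurable_fun_prod _ fun t _ => hx.measurable (f t)
  refine Integrable.mono' (g := fun ω => 1 + ∑ t ∈ Finset.range k, |x (f t) ω| ^ k) ?_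
    hm.aestronglyMeasurable (Eventually.of_forall fun ω => ?_)
  · exact (integrable_const _).add (integrable_finsetSum _ fun t _ => hx.integrable_abs_pow _ _)
  · exact abs_prod_le_one_add_sum_pow k fun t => x (f t) ω

lemma IsInputSequence.exists_abs_integral_prod_le [IsProbabilityMeasure μ]
    (hx : IsInputSequence μ x) (k : ℕ) :
    ∃ C : ℝ, ∀ f : ℕ → ℤ, |∫ ω, ∏ t ∈ Finset.range k, x (f t) ω ∂μ| ≤ C := by
  obtain ⟨C, hC⟩ := hx.moment_bound k
  refine ⟨1 + k * C, fun f => ?_⟩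
  have hi : Integrable (fun ω => ∑ t ∈ Finset.range k, |x (f t) ω| ^ k) μ :=
    integrable_finsetSum _ fun t _ => hx.integrable_abs_pow _ _
  calc |∫ ω, ∏ t ∈ Finset.range k, x (f t) ω ∂μ|
      ≤ ∫ ω, |∏ t ∈ Finset.range k, x (f t) ω| ∂μ := abs_integral_le_integral_abs
    _ ≤ ∫ ω, (1 + ∑ t ∈ Finset.range k, |x (f t) ω| ^ k) ∂μ :=
        integral_mono (hx.integrable_prod k f).abs ((integrable_const _).add hi)
          fun ω => abs_prod_le_one_add_sum_pow k fun t => x (f t) ω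
    _ = 1 + ∑ t ∈ Finset.range k, ∫ ω, |x (f t) ω| ^ k ∂μ := by
        rw [integral_add (integrable_const _) hi,
          integral_finsetSum _ fun t _ => hx.integrable_abs_pow _ _]
        simp
    _ ≤ 1 + ∑ t ∈ Finset.range k, C := by gcongr with t ht; exact hC _
    _ = _ := by simp

lemma IsInputSequence.integral_prod (hx : IsInputSequence μ x) (k : ℕ) (f : ℕ → ℤ) :
    ∫ ω, ∏ t ∈ Finset.range k, x (f t) ω ∂μ =
      ∏ v ∈ (Finset.range k).image f, ∫ ω, x v ω ^ (fiber k f v).card ∂μ := by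
  have h1 : ∀ ω, ∏ t ∈ Finset.range k, x (f t) ω =
      ∏ v : ↥((Finset.range k).image f), x v ω ^ (fiber k f v).card := by
    intro ω
    rw [Finset.prod_coe_sort ((Finset.range k).image f) (fun v => x v ω ^ (fiber k f v).card),
      ← Finset.prod_fiberwise_of_maps_to' (fun t ht => Finset.mem_image_of_mem f ht)
        (fun v => x v ω)]
    simp [fiber, Finset.prod_const]
  simp_rw [h1]
  rw [← Finset.prod_coe_sort]
  have hind : iIndepFun (fun v : ↥((Finset.range k).image f) => x v) μ :=
    hx.indep.precomp Subtype.val_injective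
  exact hind.integral_fun_prod_comp (X := fun v : ↥((Finset.range k).image f) => x v)
    (f := fun v z => z ^ (fiber k f v).card)
    (fun v => (hx.measurable v).aemeasurable)
    (fun v => (measurable_id.pow_const _).aestronglyMeasurable)

lemma IsInputSequence.integral_prod_eq_zero (hx : IsInputSequence μ x) {k : ℕ} {f : ℕ → ℤ}
    (h : ¬ Matched k f) : ∫ ω, ∏ t ∈ Finset.range k, x (f t) ω ∂μ = 0 := by
  unfold Matched at h
  push Not at h
  obtain ⟨t, ht, hu⟩ := h
  rw [hx.integral_prod]
  refine Finset.prod_eq_zero (Finset.mem_image_of_mem f (Finset.mem_range.2 ht)) ?_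
  have : fiber k f (f t) = {t} := by
    ext s
    rw [mem_fiber, Finset.mem_singleton]
    refine ⟨fun hs => by_contra fun hst => hu s hs.1 hst hs.2, ?_⟩
    rintro rfl
    exact ⟨ht, rfl⟩
  simpa [this] using hx.mean_zero (f t)

lemma IsInputSequence.integral_sq [IsProbabilityMeasure μ] (hx : IsInputSequence μ x) (α : ℤ) :
    ∫ ω, x α ω ^ 2 ∂μ = 1 := by
  rw [← hx.unit_variance α, variance_of_integral_eq_zero (hx.measurable α).aemeasurable
    (hx.mean_zero α)]

lemma IsInputSequence.integral_prod_eq_one [IsProbabilityMeasure μ] (hx : IsInputSequence μ x)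
    {k : ℕ} {f : ℕ → ℤ} (h : Matched k f) (hk : 2 * (firsts k f).card = k) :
    ∫ ω, ∏ t ∈ Finset.range k, x (f t) ω ∂μ = 1 := by
  rw [hx.integral_prod]
  refine Finset.prod_eq_one fun v hv => ?_
  rw [h.card_fiber_eq_two hk hv, hx.integral_sq]

lemma indepFun_prod (hxy : IndepFun (fun (ω : Ω) (α : ℤ) => x α ω) (fun (ω : Ω) (α : ℤ) => y α ω) μ)
    (k : ℕ) (f g : ℕ → ℤ) : IndepFun (fun ω => ∏ t ∈ Finset.range k, x (f t) ω)
      (fun ω => ∏ t ∈ Finset.range k, y (g t) ω) μ :=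
  hxy.comp (measurable_prod_apply k f) (measurable_prod_apply k g)

end Moments

/-! ### The stack of a sequence of openings -/

/-- The stack after `t` steps: a step in `O` pushes the time of its end, any other step pops. -/
def stack (O : Finset ℕ) : ℕ → List ℕ
  | 0 => [0]
  | t + 1 => if t ∈ O then (t + 1) :: stack O t else (stack O t).tail

/-- The top of the stack after `t` steps. -/
def top (O : Finset ℕ) (t : ℕ) : ℕ := (stack O t).headD 0

/-- The times that are ever on the stack. -/
def visits (O : Finset ℕ) : Finset ℕ := insert 0 (O.image (· + 1))

lemma zero_mem_visits (O : Finset ℕ) : 0 ∈ visits O := Finset.mem_insert_self _ _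

lemma succ_mem_visits {O : Finset ℕ} {s : ℕ} : s + 1 ∈ visits O ↔ s ∈ O := by
  simp [visits]

lemma card_visits (O : Finset ℕ) : (visits O).card = O.card + 1 := by
  rw [visits, Finset.card_insert_of_notMem (by simp),
    Finset.card_image_of_injective _ (add_left_injective 1)]

lemma stack_succ_of_mem {O : Finset ℕ} {t : ℕ} (h : t ∈ O) :
    stack O (t + 1) = (t + 1) :: stack O t := by simp [stack, h]

lemma stack_succ_of_notMem {O : Finset ℕ} {t : ℕ} (h : t ∉ O) :
    stack O (t + 1) = (stack O t).tail := by simp [stack, h]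

lemma le_of_mem_stack {O : Finset ℕ} {t a : ℕ} (h : a ∈ stack O t) : a ≤ t := by
  induction t with
  | zero => simpa [stack] using h
  | succ t ih =>
    by_cases ht : t ∈ O
    · rw [stack_succ_of_mem ht, List.mem_cons] at h
      rcases h with rfl | h
      · exact le_rfl
      · exact (ih h).trans t.le_succ
    · rw [stack_succ_of_notMem ht] at h
      exact (ih (List.mem_of_mem_tail h)).trans t.le_succ

lemma pairwise_stack (O : Finset ℕ) (t : ℕ) : (stack O t).Pairwise (· > ·) := by
  induction t with
  | zero => simp [stack]
  | succ t ih =>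
    by_cases ht : t ∈ O
    · rw [stack_succ_of_mem ht, List.pairwise_cons]
      exact ⟨fun a ha => Nat.lt_succ_of_le (le_of_mem_stack ha), ih⟩
    · rw [stack_succ_of_notMem ht]
      exact ih.tail

/-- What lies below `s + 1` is the stack before the step `s`. -/
lemma eq_stack_of_suffix {O : Finset ℕ} {t s : ℕ} {l : List ℕ} (h : (s + 1) :: l <:+ stack O t) :
    s ∈ O ∧ l = stack O s := by
  induction t with
  | zero =>
    rw [stack, List.suffix_cons_iff] at h
    simp at h
  | succ t ih =>
    by_cases ht : t ∈ O
    · rw [stack_succ_of_mem ht, List.suffix_cons_iff] at h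
      rcases h with h | h
      · obtain ⟨h1, rfl⟩ := List.cons.inj h
        obtain rfl : s = t := by omega
        exact ⟨ht, rfl⟩
      · exact ih h
    · rw [stack_succ_of_notMem ht] at h
      exact ih (h.trans (List.tail_suffix _))

/-- The stack is never empty during the first `k` steps. -/
def NeverEmpty (O : Finset ℕ) (k : ℕ) : Prop := ∀ t ≤ k, stack O t ≠ []

lemma NeverEmpty.mono {O : Finset ℕ} {k j : ℕ} (h : NeverEmpty O k) (hj : j ≤ k) :
    NeverEmpty O j := fun t ht => h t (ht.trans hj)

lemma NeverEmpty.zero_suffix {O : Finset ℕ} {t : ℕ} (h : NeverEmpty O t) :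
    [0] <:+ stack O t := by
  induction t with
  | zero => simp [stack]
  | succ t ih =>
    have ih := ih (h.mono t.le_succ)
    by_cases ht : t ∈ O
    · rw [stack_succ_of_mem ht]
      exact ih.trans (List.suffix_cons _ _)
    · have hne := h (t + 1) le_rfl
      rw [stack_succ_of_notMem ht] at hne ⊢
      rcases hs : stack O t with _ | ⟨a, l⟩
      · simp [hs] at hne
      · rw [hs, List.suffix_cons_iff] at ih
        rcases ih with ih | ih
        · exact absurd (by simpa [hs] using (List.cons.inj ih).2.symm) hne
        · exact ih

lemma NeverEmpty.length_stack {O : Finset ℕ} {t : ℕ} (h : NeverEmpty O t) :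
    (stack O t).length + t = 2 * (O.filter (· < t)).card + 1 := by
  induction t with
  | zero => simp [stack]
  | succ t ih =>
    have ih := ih (h.mono t.le_succ)
    have hne := h t t.le_succ
    by_cases ht : t ∈ O
    · have : O.filter (· < t + 1) = insert t (O.filter (· < t)) := by
        ext s; simp only [Finset.mem_filter, Finset.mem_insert]; grind
      rw [stack_succ_of_mem ht, this, Finset.card_insert_of_notMem (by simp), List.length_cons]
      omega
    · have : O.filter (· < t + 1) = O.filter (· < t) := by
        ext s; simp only [Finset.mem_filter]; grind
      rw [stack_succ_of_notMem ht, this, List.length_tail]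
      have := List.length_pos_of_ne_nil hne
      omega

lemma top_zero (O : Finset ℕ) : top O 0 = 0 := rfl

lemma top_succ {O : Finset ℕ} {t : ℕ} (h : t ∈ O) : top O (t + 1) = t + 1 := by
  simp [top, stack_succ_of_mem h]

lemma top_of_mem_visits {O : Finset ℕ} {t : ℕ} (h : t ∈ visits O) : top O t = t := by
  cases t with
  | zero => rfl
  | succ s => exact top_succ (succ_mem_visits.1 h)

lemma stack_eq_cons {O : Finset ℕ} {t : ℕ} (h : stack O t ≠ []) :
    stack O t = top O t :: (stack O t).tail := by
  rcases hs : stack O t with _ | ⟨a, l⟩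
  · exact absurd hs h
  · simp [top, hs]

lemma top_le (O : Finset ℕ) (t : ℕ) : top O t ≤ t := by
  by_cases h : stack O t = []
  · simp [top, h]
  · exact le_of_mem_stack (by rw [stack_eq_cons h]; simp)

lemma top_mem_visits (O : Finset ℕ) (t : ℕ) : top O t ∈ visits O := by
  by_cases h : stack O t = []
  · simp [top, h, visits]
  · rcases ht : top O t with _ | s
    · exact zero_mem_visits O
    · refine succ_mem_visits.2 (eq_stack_of_suffix (t := t) (l := (stack O t).tail) ?_).1
      rw [← ht, ← stack_eq_cons h]

lemma le_top_of_mem_stack {O : Finset ℕ} {t a : ℕ} (h : a ∈ stack O t) : a ≤ top O t := by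
  have hs := stack_eq_cons (List.ne_nil_of_mem h)
  have hp := pairwise_stack O t
  rw [hs, List.pairwise_cons] at hp
  rw [hs, List.mem_cons] at h
  rcases h with rfl | h
  · exact le_rfl
  · exact (hp.1 a h).le

/-- Popping `s + 1` restores the stack before the step `s`. -/
lemma stack_succ_of_top_eq {O : Finset ℕ} {t s : ℕ} (ht : t ∉ O) (h : top O t = s + 1) :
    s ∈ O ∧ stack O (t + 1) = stack O s ∧ s < t := by
  have hne : stack O t ≠ [] := by
    intro h0
    simp [top, h0] at h
  have hs := stack_eq_cons hne
  rw [h] at hs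
  have := eq_stack_of_suffix (t := t) (l := (stack O t).tail) (by rw [← hs])
  refine ⟨this.1, (stack_succ_of_notMem ht).trans this.2, ?_⟩
  have := top_le O t
  omega

lemma stack_eq_nil_of_top_eq_zero {O : Finset ℕ} {t : ℕ} (ht : t ∉ O) (h : top O t = 0)
    (hO : NeverEmpty O t) : stack O (t + 1) = [] := by
  rw [stack_succ_of_notMem ht]
  have hs := stack_eq_cons (hO t le_rfl)
  have hp := pairwise_stack O t
  rw [hs, List.pairwise_cons, h] at hp
  refine List.eq_nil_iff_forall_not_mem.2 fun a ha => ?_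
  have := hp.1 a ha
  omega

lemma NeverEmpty.exists_opening {O : Finset ℕ} {k t : ℕ} (hO : NeverEmpty O k) (htk : t < k)
    (ht : t ∉ O) : ∃ s ∈ O, s < t ∧ top O t = s + 1 ∧ top O (t + 1) = top O s := by
  rcases h : top O t with _ | s
  · exact absurd (stack_eq_nil_of_top_eq_zero ht h (hO.mono htk.le)) (hO _ htk)
  · obtain ⟨h1, h2, h3⟩ := stack_succ_of_top_eq ht h
    exact ⟨s, h1, h3, rfl, by rw [top, top, h2]⟩

lemma NeverEmpty.stack_eq {O : Finset ℕ} {k : ℕ} (hO : NeverEmpty O k) (hk : 2 * O.card = k)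
    (hOk : O ⊆ Finset.range k) : stack O k = [0] := by
  have hl := hO.length_stack
  rw [Finset.filter_true_of_mem fun t ht => Finset.mem_range.1 (hOk ht)] at hl
  exact (hO.zero_suffix.eq_of_length (by simp; omega)).symm

lemma NeverEmpty.exists_closing {O : Finset ℕ} {k t : ℕ} (hO : NeverEmpty O k)
    (hk : 2 * O.card = k) (hOk : O ⊆ Finset.range k) (ht : t ∈ O) :
    ∃ r < k, t < r ∧ r ∉ O ∧ top O r = t + 1 ∧ top O (r + 1) = top O t := by
  by_contra! hcon
  have key : ∀ r, t + 1 ≤ r → r ≤ k → t + 1 ∈ stack O r := by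
    intro r hr
    induction r, hr using Nat.le_induction with
    | base => intro _; rw [stack_succ_of_mem ht]; simp
    | succ r hr ih =>
      intro hrk
      have ih := ih (by omega)
      by_cases hrO : r ∈ O
      · rw [stack_succ_of_mem hrO]; exact List.mem_cons_of_mem _ ih
      · have hs := stack_eq_cons (hO r (by omega))
        rw [stack_succ_of_notMem hrO]
        rw [hs, List.mem_cons] at ih
        rcases ih with ih | ih
        · refine absurd ?_ (hcon r (by omega) (by omega) hrO ih.symm)
          rw [top, top, (stack_succ_of_top_eq hrO ih.symm).2.1]
        · exact ih
  have := key k (Finset.mem_range.1 (hOk ht)) le_rfl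
  rw [hO.stack_eq hk hOk] at this
  simp at this

/-! ### Generic configurations -/

/-- The numbers `P t`, `t ∈ T`, satisfy no nontrivial linear relation with integer coefficients
of absolute value at most `6`. -/
def Generic (T : Finset ℕ) (P : ℕ → ℤ) : Prop :=
  ∀ c : ℕ → ℤ, (∀ t, |c t| ≤ 6) → ∑ t ∈ T, c t * P t = 0 → ∀ t ∈ T, c t = 0

lemma Generic.congr {T : Finset ℕ} {P Q : ℕ → ℤ} (h : Generic T P) (hPQ : ∀ t ∈ T, P t = Q t) :
    Generic T Q := fun c hc hs =>
  h c hc (by rw [← hs]; exact Finset.sum_congr rfl fun t ht => by rw [hPQ t ht])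

/-- The Toeplitz index of the step `t`. -/
def toeplitzIndex (P : ℕ → ℤ) (t : ℕ) : ℤ := |P t - P (t + 1)|

/-- The Hankel index of the step `t`. -/
def hankelIndex (P : ℕ → ℤ) (t : ℕ) : ℤ := P t + P (t + 1)

lemma Generic.sum_indicator_eq_zero {T : Finset ℕ} {P : ℕ → ℤ} (hG : Generic T P) {N : ℕ}
    (hN : N ≤ 6) (z : Fin N → ℤ) (v : Fin N → ℕ) (hz : ∀ j, |z j| ≤ 1) (hv : ∀ j, v j ∈ T)
    (h : ∑ j, z j * P (v j) = 0) (t : ℕ) (ht : t ∈ T) :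
    ∑ j, z j * (if t = v j then 1 else 0) = 0 := by
  refine hG (fun t => ∑ j, z j * (if t = v j then 1 else 0)) (fun t => ?_) ?_ t ht
  · calc |∑ j, z j * (if t = v j then 1 else 0)|
        ≤ ∑ j, |z j * (if t = v j then 1 else 0)| := Finset.abs_sum_le_sum_abs _ _
      _ ≤ ∑ j : Fin N, 1 := Finset.sum_le_sum fun j _ => by
          split_ifs
          · simpa using hz j
          · simp
      _ ≤ 6 := by simpa using hN
  · simp_rw [Finset.sum_mul]
    rw [Finset.sum_comm]
    refine (Finset.sum_congr rfl fun j _ => ?_).trans h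
    simp [hv j]

/-- In a generic configuration a step whose Toeplitz and Hankel indices are those of edges
`{a', a}` and `{b', b}` runs along the edge `{a', a}`. -/
lemma Generic.eq_of_index_eq {T : Finset ℕ} {P : ℕ → ℤ} (hG : Generic T P) {i a a' b b' : ℕ}
    (hi : i ∈ T) (ha : a ∈ T) (ha' : a' ∈ T) (hb : b ∈ T) (hb' : b' ∈ T) (haa : a' < a)
    (hbb : b' < b) {q : ℤ} (h1 : |P i - q| = |P a' - P a|) (h2 : P i + q = P b' + P b) :
    (i = a ∧ q = P a') ∨ (i = a' ∧ q = P a) := by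
  rcases abs_eq_abs.1 h1 with h | h
  · have key := hG.sum_indicator_eq_zero le_rfl ![1, 1, 1, -1, -1, -1] ![i, i, a, a', b, b']
      (by intro j; fin_cases j <;> simp) (by intro j; fin_cases j <;> simpa)
      (by simp [Fin.sum_univ_six]; linarith)
    simp only [Fin.sum_univ_six, Matrix.cons_val] at key
    have k1 := key i hi
    have k2 := key a ha
    have k3 := key a' ha'
    have k4 := key b hb
    have k5 := key b' hb'
    right
    have : i = a' := by
      clear h h1 h2 key
      split_ifs at k1 k2 k3 k4 k5 <;> omega
    subst this
    exact ⟨rfl, by linarith⟩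
  · have key := hG.sum_indicator_eq_zero le_rfl ![1, 1, -1, 1, -1, -1] ![i, i, a, a', b, b']
      (by intro j; fin_cases j <;> simp) (by intro j; fin_cases j <;> simpa)
      (by simp [Fin.sum_univ_six]; linarith)
    simp only [Fin.sum_univ_six, Matrix.cons_val] at key
    have k1 := key i hi
    have k2 := key a ha
    have k3 := key a' ha'
    have k4 := key b hb
    have k5 := key b' hb'
    left
    have : i = a := by
      clear h h1 h2 key
      split_ifs at k1 k2 k3 k4 k5 <;> omega
    subst this
    exact ⟨rfl, by linarith⟩

lemma Generic.abs_sub_ne {T : Finset ℕ} {P : ℕ → ℤ} (hG : Generic T P) {a a' b b' : ℕ}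
    (ha : a ∈ T) (ha' : a' ∈ T) (hb : b ∈ T) (hb' : b' ∈ T) (haa : a' < a)
    (hbb : b' < b) (hab : a < b) : |P a' - P a| ≠ |P b' - P b| := by
  intro h
  rcases abs_eq_abs.1 h with h | h
  · have key := hG.sum_indicator_eq_zero (N := 4) (by norm_num) ![1, -1, -1, 1] ![a', a, b', b]
      (by intro j; fin_cases j <;> simp) (by intro j; fin_cases j <;> simpa)
      (by simp [Fin.sum_univ_four]; linarith) b hb
    simp [Fin.sum_univ_four, hab.ne', hbb.ne', (haa.trans hab).ne'] at key
  · have key := hG.sum_indicator_eq_zero (N := 4) (by norm_num) ![1, -1, 1, -1] ![a', a, b', b]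
      (by intro j; fin_cases j <;> simp) (by intro j; fin_cases j <;> simpa)
      (by simp [Fin.sum_univ_four]; linarith) b hb
    simp [Fin.sum_univ_four, hab.ne', hbb.ne', (haa.trans hab).ne'] at key

lemma Generic.add_ne {T : Finset ℕ} {P : ℕ → ℤ} (hG : Generic T P) {a a' b b' : ℕ}
    (ha : a ∈ T) (ha' : a' ∈ T) (hb : b ∈ T) (hb' : b' ∈ T) (haa : a' < a)
    (hbb : b' < b) (hab : a < b) : P a' + P a ≠ P b' + P b := by
  intro h
  have key := hG.sum_indicator_eq_zero (N := 4) (by norm_num) ![1, 1, -1, -1] ![a', a, b', b]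
    (by intro j; fin_cases j <;> simp) (by intro j; fin_cases j <;> simpa)
    (by simp [Fin.sum_univ_four]; linarith) b hb
  simp [Fin.sum_univ_four, hab.ne', hbb.ne', (haa.trans hab).ne'] at key

/-! ### Generic matched walks -/

/-- The steps at which both the Toeplitz and the Hankel index are new. -/
noncomputable def openings (k : ℕ) (P : ℕ → ℤ) : Finset ℕ :=
  (firsts k (toeplitzIndex P)) ∩ (firsts k (hankelIndex P))

/-- Every Toeplitz index and every Hankel index of the walk occurs at least twice. -/
def WalkMatched (k : ℕ) (P : ℕ → ℤ) : Prop :=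
  Matched k (toeplitzIndex P) ∧ Matched k (hankelIndex P)

lemma openings_subset_range (k : ℕ) (P : ℕ → ℤ) : openings k P ⊆ Finset.range k := fun _ ht =>
  Finset.mem_range.2 (mem_firsts.1 (Finset.mem_inter.1 ht).1).1

lemma WalkMatched.two_mul_card_openings_le {k : ℕ} {P : ℕ → ℤ} (h : WalkMatched k P) :
    2 * (openings k P).card ≤ k :=
  (Nat.mul_le_mul_left 2 (Finset.card_le_card Finset.inter_subset_left)).trans
    h.1.two_mul_card_firsts_le

lemma WalkMatched.firsts_toeplitzIndex {k : ℕ} {P : ℕ → ℤ} (h : WalkMatched k P)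
    (hk : 2 * (openings k P).card = k) : firsts k (toeplitzIndex P) = openings k P := by
  refine (Finset.eq_of_subset_of_card_le Finset.inter_subset_left ?_).symm
  have := h.1.two_mul_card_firsts_le
  change _ ≤ (openings k P).card
  omega

lemma WalkMatched.firsts_hankelIndex {k : ℕ} {P : ℕ → ℤ} (h : WalkMatched k P)
    (hk : 2 * (openings k P).card = k) : firsts k (hankelIndex P) = openings k P := by
  refine (Finset.eq_of_subset_of_card_le Finset.inter_subset_right ?_).symm
  have := h.2.two_mul_card_firsts_le
  change _ ≤ (openings k P).card
  omega

/-- A generic matched walk with the largest possible number of openings follows its stack. -/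
lemma WalkMatched.follows_stack {k : ℕ} {P : ℕ → ℤ} (h : WalkMatched k P)
    (hk : 2 * (openings k P).card = k) (hG : Generic (visits (openings k P)) P) :
    ∀ t ≤ k, stack (openings k P) t ≠ [] ∧ P t = P (top (openings k P) t) := by
  have hX := h.firsts_toeplitzIndex hk
  have hY := h.firsts_hankelIndex hk
  set O := openings k P with hO
  suffices H : ∀ t ≤ k, NeverEmpty O t ∧ (∀ s ≤ t, P s = P (top O s)) ∧
      ∀ s ∈ O, s < t → s + 1 ∉ stack O t →
        ∃ r, s < r ∧ r < t ∧ toeplitzIndex P r = toeplitzIndex P s from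
    fun t ht => ⟨(H t ht).1 t le_rfl, (H t ht).2.1 t le_rfl⟩
  intro t
  induction t with
  | zero =>
    intro _
    refine ⟨fun s hs => ?_, fun s hs => ?_, fun s _ hs => absurd hs (by omega)⟩
    · simp [Nat.le_zero.1 hs, stack]
    · rw [Nat.le_zero.1 hs, top_zero]
  | succ t ih =>
    intro htk
    obtain ⟨hne, hP, hcl⟩ := ih (by omega)
    by_cases ht : t ∈ O
    · refine ⟨fun s hs => ?_, fun s hs => ?_, fun s hsO hs hmem => ?_⟩
      · rcases Nat.le_succ_iff.1 hs with hs | rfl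
        · exact hne s hs
        · simp [stack_succ_of_mem ht]
      · rcases Nat.le_succ_iff.1 hs with hs | rfl
        · exact hP s hs
        · rw [top_succ ht]
      · rw [stack_succ_of_mem ht, List.mem_cons, not_or] at hmem
        obtain ⟨r, h1, h2, h3⟩ := hcl s hsO (by omega) hmem.2
        exact ⟨r, h1, by omega, h3⟩
    · obtain ⟨s, hs, hst, hsX⟩ := exists_mem_firsts (toeplitzIndex P) (t := t) htk
      obtain ⟨s', hs', hst', hsY⟩ := exists_mem_firsts (hankelIndex P) (t := t) htk
      rw [hX] at hs
      rw [hY] at hs'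
      have hst : s < t := lt_of_le_of_ne hst (by rintro rfl; exact ht hs)
      have hst' : s' < t := lt_of_le_of_ne hst' (by rintro rfl; exact ht hs')
      have hle := top_le O s
      have hle' := top_le O s'
      have hdich := hG.eq_of_index_eq (top_mem_visits O t) (succ_mem_visits.2 hs)
        (top_mem_visits O s) (succ_mem_visits.2 hs') (top_mem_visits O s') (by omega) (by omega)
        (q := P (t + 1)) (by rw [← hP t le_rfl, ← hP s hst.le]; exact hsX.symm)
        (by rw [← hP t le_rfl, ← hP s' hst'.le]; exact hsY.symm)
      rcases hdich with ⟨htop, hq⟩ | ⟨htop, hq⟩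
      · obtain ⟨-, hstk, -⟩ := stack_succ_of_top_eq ht htop
        have hts : top O (t + 1) = top O s := by rw [top, top, hstk]
        refine ⟨fun r hr => ?_, fun r hr => ?_, fun r hrO hr hmem => ?_⟩
        · rcases Nat.le_succ_iff.1 hr with hr | rfl
          · exact hne r hr
          · rw [hstk]; exact hne s hst.le
        · rcases Nat.le_succ_iff.1 hr with hr | rfl
          · exact hP r hr
          · rw [hts, hq]
        · have hrt : r < t := lt_of_le_of_ne (by omega) (by rintro rfl; exact ht hrO)
          by_cases hr1 : r + 1 ∈ stack O t
          · rw [stack_succ_of_notMem ht] at hmem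
            rw [stack_eq_cons (hne t le_rfl), List.mem_cons] at hr1
            rcases hr1 with hr1 | hr1
            · obtain rfl : r = s := by omega
              exact ⟨t, hrt, by omega, hsX.symm⟩
            · exact absurd hr1 hmem
          · obtain ⟨q, h1, h2, h3⟩ := hcl r hrO hrt hr1
            exact ⟨q, h1, by omega, h3⟩
      · exfalso
        have hnot : s + 1 ∉ stack O t := fun hmem => by
          have := le_top_of_mem_stack hmem
          omega
        obtain ⟨r, hsr, hrt, hrX⟩ := hcl s hs hst hnot
        have hc := h.1.card_fiber_eq_two (by rw [hX, hk])
          (Finset.mem_image_of_mem (toeplitzIndex P) (Finset.mem_range.2 (show t < k from htk)))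
        have hsub : ({s, r, t} : Finset ℕ) ⊆ fiber k (toeplitzIndex P) (toeplitzIndex P t) := by
          intro j hj
          simp only [Finset.mem_insert, Finset.mem_singleton] at hj
          rcases hj with rfl | rfl | rfl
          · exact mem_fiber.2 ⟨by omega, hsX⟩
          · exact mem_fiber.2 ⟨by omega, hrX.trans hsX⟩
          · exact mem_fiber.2 ⟨by omega, rfl⟩
        have hcard := Finset.card_le_card hsub
        rw [hc, Finset.card_eq_three.2 ⟨s, r, t, by omega, by omega, by omega, rfl⟩] at hcard
        omega

/-- The walk that follows the stack and has prescribed positions at the times of `visits O`. -/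
def stackWalk (O : Finset ℕ) (u : ℕ → ℤ) (t : ℕ) : ℤ := u (top O t)

lemma stackWalk_of_mem {O : Finset ℕ} {t : ℕ} (u : ℕ → ℤ) (h : t ∈ visits O) :
    stackWalk O u t = u t := by rw [stackWalk, top_of_mem_visits h]

section StackWalk

variable {O : Finset ℕ} {k : ℕ} {u : ℕ → ℤ}

lemma exists_opening_index_eq (hO : NeverEmpty O k) {t : ℕ} (htk : t < k) (ht : t ∉ O) :
    ∃ s ∈ O, s < t ∧ toeplitzIndex (stackWalk O u) s = toeplitzIndex (stackWalk O u) t ∧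
      hankelIndex (stackWalk O u) s = hankelIndex (stackWalk O u) t := by
  obtain ⟨s, hs, hst, h1, h2⟩ := hO.exists_opening htk ht
  refine ⟨s, hs, hst, ?_, ?_⟩
  · rw [toeplitzIndex, toeplitzIndex, stackWalk, stackWalk, stackWalk, stackWalk, top_succ hs, h1,
      h2, abs_sub_comm]
  · rw [hankelIndex, hankelIndex, stackWalk, stackWalk, stackWalk, stackWalk, top_succ hs, h1,
      h2, add_comm]

lemma stackWalk_matched (hO : NeverEmpty O k) (hk : 2 * O.card = k) (hOk : O ⊆ Finset.range k) :
    WalkMatched k (stackWalk O u) := by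
  have key : ∀ t < k, ∃ s < k, s ≠ t ∧
      toeplitzIndex (stackWalk O u) s = toeplitzIndex (stackWalk O u) t ∧
      hankelIndex (stackWalk O u) s = hankelIndex (stackWalk O u) t := by
    intro t htk
    by_cases ht : t ∈ O
    · obtain ⟨r, hrk, htr, -, h1, h2⟩ := hO.exists_closing hk hOk ht
      refine ⟨r, hrk, htr.ne', ?_, ?_⟩
      · rw [toeplitzIndex, toeplitzIndex, stackWalk, stackWalk, stackWalk, stackWalk, top_succ ht,
          h1, h2, abs_sub_comm]
      · rw [hankelIndex, hankelIndex, stackWalk, stackWalk, stackWalk, stackWalk, top_succ ht, h1,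
          h2, add_comm]
    · obtain ⟨s, -, hst, h1, h2⟩ := exists_opening_index_eq (u := u) hO htk ht
      exact ⟨s, hst.trans htk, hst.ne, h1, h2⟩
  constructor
  · intro t ht
    obtain ⟨s, h1, h2, h3, -⟩ := key t ht
    exact ⟨s, h1, h2, h3⟩
  · intro t ht
    obtain ⟨s, h1, h2, -, h3⟩ := key t ht
    exact ⟨s, h1, h2, h3⟩

lemma stackWalk_zero_eq (hO : NeverEmpty O k) (hk : 2 * O.card = k) (hOk : O ⊆ Finset.range k) :
    stackWalk O u 0 = stackWalk O u k := by
  simp [stackWalk, top, hO.stack_eq hk hOk, stack]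

lemma openings_stackWalk (hO : NeverEmpty O k) (hOk : O ⊆ Finset.range k)
    (hG : Generic (visits O) u) : openings k (stackWalk O u) = O := by
  have hdist : ∀ s ∈ O, ∀ t ∈ O, s < t →
      toeplitzIndex (stackWalk O u) s ≠ toeplitzIndex (stackWalk O u) t ∧
      hankelIndex (stackWalk O u) s ≠ hankelIndex (stackWalk O u) t := by
    intro s hs t ht hst
    have h1 := top_le O s
    have h2 := top_le O t
    rw [toeplitzIndex, toeplitzIndex, hankelIndex, hankelIndex, stackWalk, stackWalk, stackWalk,
      stackWalk, top_succ hs, top_succ ht]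
    exact ⟨hG.abs_sub_ne (succ_mem_visits.2 hs) (top_mem_visits O s) (succ_mem_visits.2 ht)
        (top_mem_visits O t) (by omega) (by omega) (by omega),
      hG.add_ne (succ_mem_visits.2 hs) (top_mem_visits O s) (succ_mem_visits.2 ht)
        (top_mem_visits O t) (by omega) (by omega) (by omega)⟩
  ext t
  rw [openings, Finset.mem_inter, mem_firsts, mem_firsts]
  constructor
  · rintro ⟨⟨htk, h⟩, -⟩
    by_contra ht
    obtain ⟨s, -, hst, h1, -⟩ := exists_opening_index_eq (u := u) hO htk ht
    exact h s hst h1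
  · intro ht
    have htk := Finset.mem_range.1 (hOk ht)
    refine ⟨⟨htk, fun s hst => ?_⟩, ⟨htk, fun s hst => ?_⟩⟩
    · by_cases hs : s ∈ O
      · exact (hdist s hs t ht hst).1
      · obtain ⟨r, hr, hrs, h1, -⟩ := exists_opening_index_eq (u := u) hO (hst.trans htk) hs
        rw [← h1]
        exact (hdist r hr t ht (hrs.trans hst)).1
    · by_cases hs : s ∈ O
      · exact (hdist s hs t ht hst).2
      · obtain ⟨r, hr, hrs, -, h1⟩ := exists_opening_index_eq (u := u) hO (hst.trans htk) hs
        rw [← h1]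
        exact (hdist r hr t ht (hrs.trans hst)).2

end StackWalk

/-! ### Counting the stacks -/

/-- The sequence of up and down steps described by a set of openings. -/
def stepWord (O : Finset ℕ) (k : ℕ) : List DyckStep :=
  (List.range k).map fun t => if t ∈ O then DyckStep.U else DyckStep.D

lemma stepWord_succ (O : Finset ℕ) (k : ℕ) :
    stepWord O (k + 1) = stepWord O k ++ [if k ∈ O then DyckStep.U else DyckStep.D] := by
  simp [stepWord, List.range_succ]

lemma take_stepWord (O : Finset ℕ) (k i : ℕ) : (stepWord O k).take i = stepWord O (min i k) := by
  rw [stepWord, ← List.map_take, List.take_range, stepWord]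

lemma card_filter_lt_succ (O : Finset ℕ) (t : ℕ) :
    (O.filter (· < t + 1)).card = (O.filter (· < t)).card + if t ∈ O then 1 else 0 := by
  by_cases ht : t ∈ O
  · have : O.filter (· < t + 1) = insert t (O.filter (· < t)) := by
      ext s; simp only [Finset.mem_filter, Finset.mem_insert]; grind
    rw [this, Finset.card_insert_of_notMem (by simp), if_pos ht]
  · have : O.filter (· < t + 1) = O.filter (· < t) := by
      ext s; simp only [Finset.mem_filter]; grind
    rw [this, if_neg ht, add_zero]

lemma count_U_stepWord (O : Finset ℕ) (k : ℕ) :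
    (stepWord O k).count DyckStep.U = (O.filter (· < k)).card := by
  induction k with
  | zero => simp [stepWord]
  | succ k ih =>
    rw [stepWord_succ, List.count_append, ih, card_filter_lt_succ]
    split_ifs <;> simp

lemma count_D_stepWord (O : Finset ℕ) (k : ℕ) :
    (stepWord O k).count DyckStep.D + (O.filter (· < k)).card = k := by
  induction k with
  | zero => simp [stepWord]
  | succ k ih =>
    rw [stepWord_succ, List.count_append, card_filter_lt_succ]
    split_ifs <;> simp <;> omega

lemma neverEmpty_iff {O : Finset ℕ} {k : ℕ} :
    NeverEmpty O k ↔ ∀ t ≤ k, t ≤ 2 * (O.filter (· < t)).card := by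
  constructor
  · intro h t ht
    have h1 := (h.mono ht).length_stack
    have h2 := List.length_pos_of_ne_nil (h t ht)
    omega
  · intro h
    induction k with
    | zero =>
      intro t ht
      simp [Nat.le_zero.1 ht, stack]
    | succ k ih =>
      have ih := ih fun t ht => h t (ht.trans k.le_succ)
      intro t ht
      rcases Nat.le_succ_iff.1 ht with ht | rfl
      · exact ih t ht
      · by_cases hk : k ∈ O
        · simp [stack_succ_of_mem hk]
        · have h1 := ih.length_stack
          have h2 := h (k + 1) le_rfl
          rw [card_filter_lt_succ, if_neg hk] at h2
          rw [stack_succ_of_notMem hk]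
          refine List.ne_nil_of_length_pos ?_
          rw [List.length_tail]
          omega

open scoped Classical in
/-- The sets of `k / 2` openings among `k` steps for which the stack is never empty. -/
noncomputable def dyckOpenings (k : ℕ) : Finset (Finset ℕ) :=
  (Finset.range k).powerset.filter fun O => 2 * O.card = k ∧ NeverEmpty O k

lemma mem_dyckOpenings {k : ℕ} {O : Finset ℕ} :
    O ∈ dyckOpenings k ↔ O ⊆ Finset.range k ∧ 2 * O.card = k ∧ NeverEmpty O k := by
  simp [dyckOpenings]

lemma filter_lt_eq_self {O : Finset ℕ} {k : ℕ} (h : O ⊆ Finset.range k) :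
    O.filter (· < k) = O :=
  Finset.filter_true_of_mem fun _ ht => Finset.mem_range.1 (h ht)

/-- The Dyck word of a set of openings. -/
def dyckWordOfOpenings {k : ℕ} {O : Finset ℕ}
    (h : O ⊆ Finset.range k ∧ 2 * O.card = k ∧ NeverEmpty O k) : DyckWord where
  toList := stepWord O k
  count_U_eq_count_D := by
    have h1 := count_D_stepWord O k
    rw [count_U_stepWord]
    rw [filter_lt_eq_self h.1] at *
    omega
  count_D_le_count_U i := by
    rw [take_stepWord, count_U_stepWord]
    have h1 := count_D_stepWord O (min i k)
    have h2 := neverEmpty_iff.1 h.2.2 (min i k) (min_le_right _ _)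
    omega

lemma mem_iff_getElem?_stepWord {O : Finset ℕ} {k t : ℕ} (ht : t < k) :
    (stepWord O k)[t]? = some DyckStep.U ↔ t ∈ O := by
  by_cases h : t ∈ O <;> simp [stepWord, ht, h]

lemma stepWord_filter (L : List DyckStep) :
    stepWord ((Finset.range L.length).filter fun t => L[t]? = some DyckStep.U) L.length = L := by
  refine List.ext_getElem (by simp [stepWord]) fun t h1 h2 => ?_
  have := L[t].dichotomy
  rcases this with h | h <;> simp [stepWord, h2, h]

lemma card_dyckOpenings_two_mul (m : ℕ) : (dyckOpenings (2 * m)).card = catalan m := by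
  rw [← DyckWord.card_dyckWord_semilength_eq_catalan, ← Finset.card_univ]
  refine Finset.card_bij (fun O hO => ⟨dyckWordOfOpenings (mem_dyckOpenings.1 hO), ?_⟩)
    (fun _ _ => Finset.mem_univ _) ?_ ?_
  · have h := mem_dyckOpenings.1 hO
    rw [DyckWord.semilength]
    change (stepWord O (2 * m)).count DyckStep.U = m
    rw [count_U_stepWord, filter_lt_eq_self h.1]
    omega
  · intro O hO O' hO' heq
    have hw : stepWord O (2 * m) = stepWord O' (2 * m) :=
      congrArg (fun p => p.1.toList) heq
    have h := (mem_dyckOpenings.1 hO).1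
    have h' := (mem_dyckOpenings.1 hO').1
    ext t
    by_cases ht : t < 2 * m
    · rw [← mem_iff_getElem?_stepWord ht, hw, mem_iff_getElem?_stepWord ht]
    · exact ⟨fun h1 => absurd (Finset.mem_range.1 (h h1)) ht,
        fun h1 => absurd (Finset.mem_range.1 (h' h1)) ht⟩
  · rintro ⟨p, hp⟩ -
    have hl := p.two_mul_semilength_eq_length
    rw [hp] at hl
    have hw := stepWord_filter p.toList
    rw [← hl] at hw
    set O := (Finset.range (2 * m)).filter fun t => p.toList[t]? = some DyckStep.U with hO
    have hOk : O ⊆ Finset.range (2 * m) := Finset.filter_subset _ _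
    have hcard : O.card = m := by
      rw [← hp, DyckWord.semilength, ← hw, count_U_stepWord, filter_lt_eq_self hOk]
    have hmem : O ∈ dyckOpenings (2 * m) := by
      refine mem_dyckOpenings.2 ⟨hOk, by rw [hcard], neverEmpty_iff.2 fun t ht => ?_⟩
      have h1 := p.count_D_le_count_U t
      rw [← hw, take_stepWord, min_eq_left ht, count_U_stepWord] at h1
      have h2 := count_D_stepWord O t
      omega
    exact ⟨O, hmem, Subtype.ext (DyckWord.ext hw)⟩

lemma dyckOpenings_of_odd {k : ℕ} (hk : ¬ Even k) : dyckOpenings k = ∅ := by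
  refine Finset.eq_empty_of_forall_notMem fun O hO => hk ?_
  have := (mem_dyckOpenings.1 hO).2.1
  exact ⟨O.card, by omega⟩

lemma card_dyckOpenings (k : ℕ) : ((dyckOpenings k).card : ℝ) = semicircularMoment k := by
  unfold semicircularMoment
  split_ifs with hk
  · obtain ⟨m, rfl⟩ := hk
    rw [← two_mul, card_dyckOpenings_two_mul, Nat.mul_div_cancel_left m two_pos]
  · rw [dyckOpenings_of_odd hk]
    simp

/-! ### Counting nongeneric configurations -/

/-- The positions `1, …, n` given by `u`, extended by zero. -/
def placement {T : Finset ℕ} {n : ℕ} (u : T → Fin n) (t : ℕ) : ℤ :=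
  if h : t ∈ T then ((u ⟨t, h⟩ : ℕ) : ℤ) + 1 else 0

lemma sum_mul_placement {T : Finset ℕ} {n : ℕ} (u : T → Fin n) (c : ℕ → ℤ) :
    ∑ t ∈ T, c t * placement u t = ∑ t : T, c t * (((u t : ℕ) : ℤ) + 1) := by
  rw [← Finset.sum_coe_sort]
  exact Finset.sum_congr rfl fun t _ => by rw [placement, dif_pos t.2]

lemma card_relation_le {T : Finset ℕ} {n : ℕ} (c : T → ℤ) {a : T} (ha : c a ≠ 0) :
    (Finset.univ.filter fun u : T → Fin n =>
      ∑ t, c t * (((u t : ℕ) : ℤ) + 1) = 0).card ≤ n ^ (T.card - 1) := by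
  have hcard : Fintype.card ({t : T // t ≠ a} → Fin n) = n ^ (T.card - 1) := by
    rw [Fintype.card_fun, Fintype.card_fin, Fintype.card_subtype_compl, Fintype.card_subtype_eq,
      Fintype.card_coe]
  rw [← hcard, ← Finset.card_univ]
  refine Finset.card_le_card_of_injOn (fun u t => u t.1) (fun _ _ => Finset.mem_univ _) ?_
  intro u hu v hv huv
  have hne : ∀ t, t ≠ a → u t = v t := fun t ht => congrFun huv ⟨t, ht⟩
  have hu : ∑ t, c t * (((u t : ℕ) : ℤ) + 1) = 0 :=
    (Finset.mem_filter.1 (Finset.mem_coe.1 hu)).2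
  have hv : ∑ t, c t * (((v t : ℕ) : ℤ) + 1) = 0 :=
    (Finset.mem_filter.1 (Finset.mem_coe.1 hv)).2
  rw [← Finset.add_sum_erase _ _ (Finset.mem_univ a)] at hu hv
  have hs : ∑ t ∈ Finset.univ.erase a, c t * (((u t : ℕ) : ℤ) + 1) =
      ∑ t ∈ Finset.univ.erase a, c t * (((v t : ℕ) : ℤ) + 1) :=
    Finset.sum_congr rfl fun t ht => by rw [hne t (Finset.ne_of_mem_erase ht)]
  have hca : c a * (((u a : ℕ) : ℤ) + 1) = c a * (((v a : ℕ) : ℤ) + 1) := by linarith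
  have hua := mul_left_cancel₀ ha hca
  funext t
  by_cases ht : t = a
  · subst ht
    exact Fin.ext (by omega)
  · exact hne t ht

open scoped Classical in
/-- The nongeneric placements. -/
noncomputable def nongeneric (T : Finset ℕ) (n : ℕ) : Finset (T → Fin n) :=
  Finset.univ.filter fun u => ¬ Generic T (placement u)

lemma mem_nongeneric {T : Finset ℕ} {n : ℕ} {u : T → Fin n} :
    u ∈ nongeneric T n ↔ ¬ Generic T (placement u) := by
  simp [nongeneric]

lemma exists_card_nongeneric_le (T : Finset ℕ) :
    ∃ C : ℕ, ∀ n, (nongeneric T n).card ≤ C * n ^ (T.card - 1) := by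
  classical
  let I := (T → ↥(Finset.Icc (-6 : ℤ) 6)) × T
  let rel (n : ℕ) (q : I) : Finset (T → Fin n) := if (q.1 q.2 : ℤ) = 0 then ∅ else
    Finset.univ.filter fun u : T → Fin n => ∑ t, (q.1 t : ℤ) * (((u t : ℕ) : ℤ) + 1) = 0
  refine ⟨Fintype.card I, fun n => ?_⟩
  have hsub : nongeneric T n ⊆ Finset.univ.biUnion (rel n) := by
    intro u hu
    rw [mem_nongeneric, Generic] at hu
    push Not at hu
    obtain ⟨c, hc, hs, a, ha, hca⟩ := hu
    rw [sum_mul_placement] at hs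
    refine Finset.mem_biUnion.2
      ⟨⟨fun t => ⟨c t, Finset.mem_Icc.2 (abs_le.1 (hc t))⟩, ⟨a, ha⟩⟩, Finset.mem_univ _, ?_⟩
    simpa [rel, hca] using hs
  refine (Finset.card_le_card hsub).trans (Finset.card_biUnion_le_card_mul _ _ _ fun q _ => ?_)
  by_cases h : (q.1 q.2 : ℤ) = 0
  · simp [rel, h]
  · simp only [rel, if_neg h]
    exact card_relation_le (fun t => (q.1 t : ℤ)) h

/-! ### Counting walks -/

/-- The positions `1, …, n` of a walk of `k` steps, as a function on the natural numbers. -/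
def position {k n : ℕ} (p : Fin (k + 1) → Fin n) (t : ℕ) : ℤ :=
  ((p (Fin.ofNat (k + 1) t) : ℕ) : ℤ) + 1

/-- The positions of a walk at the times in `T`. -/
def restrictTo {k n : ℕ} (T : Finset ℕ) (p : Fin (k + 1) → Fin n) (t : T) : Fin n :=
  p (Fin.ofNat (k + 1) t)

lemma placement_restrictTo {k n : ℕ} {T : Finset ℕ} (p : Fin (k + 1) → Fin n) {t : ℕ}
    (ht : t ∈ T) : placement (restrictTo T p) t = position p t := by
  rw [placement, dif_pos ht, restrictTo, position]

lemma position_val {k n : ℕ} (p : Fin (k + 1) → Fin n) (t : Fin (k + 1)) :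
    position p t = ((p t : ℕ) : ℤ) + 1 := by
  rw [position, Fin.ofNat_eq_cast, Fin.cast_val_eq_self]

lemma eq_of_position_eq {k n : ℕ} {p q : Fin (k + 1) → Fin n}
    (h : ∀ t ≤ k, position p t = position q t) : p = q := by
  funext t
  have := h t (Nat.le_of_lt_succ t.2)
  rw [position_val, position_val] at this
  exact Fin.ext (by omega)

lemma generic_restrictTo_iff {k n : ℕ} {T : Finset ℕ} {p : Fin (k + 1) → Fin n} :
    Generic T (placement (restrictTo T p)) ↔ Generic T (position p) :=
  ⟨fun h => h.congr fun _ ht => placement_restrictTo p ht,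
    fun h => h.congr fun _ ht => (placement_restrictTo p ht).symm⟩

/-- The step `t` repeats the index of the step `s` in the manner `e`. -/
def Repeats (P : ℕ → ℤ) (t s : ℕ) (e : Fin 3) : Prop :=
  (e = 0 → P t - P (t + 1) = P s - P (s + 1)) ∧
  (e = 1 → P t - P (t + 1) = -(P s - P (s + 1))) ∧
  (e = 2 → P t + P (t + 1) = P s + P (s + 1))

lemma exists_repeats {k : ℕ} {P : ℕ → ℤ} {t : ℕ} (htk : t < k) (ht : t ∉ openings k P) :
    ∃ s < t, ∃ e, Repeats P t s e := by
  have : ∃ s < t, toeplitzIndex P s = toeplitzIndex P t ∨ hankelIndex P s = hankelIndex P t := by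
    by_contra! h
    exact ht (Finset.mem_inter.2 ⟨mem_firsts.2 ⟨htk, fun s hs => (h s hs).1⟩,
      mem_firsts.2 ⟨htk, fun s hs => (h s hs).2⟩⟩)
  obtain ⟨s, hs, h | h⟩ := this
  · rcases abs_eq_abs.1 h.symm with h | h
    · exact ⟨s, hs, 0, fun _ => h, by simp, by simp⟩
    · exact ⟨s, hs, 1, by simp, fun _ => h, by simp⟩
  · exact ⟨s, hs, 2, by simp, by simp, fun _ => h.symm⟩

lemma Repeats.eq_of_eq {P Q : ℕ → ℤ} {t s : ℕ} {e : Fin 3} (hP : Repeats P t s e)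
    (hQ : Repeats Q t s e) (hs : s < t) (h : ∀ r ≤ t, P r = Q r) : P (t + 1) = Q (t + 1) := by
  have h1 := h t le_rfl
  have h2 := h s hs.le
  have h3 := h (s + 1) hs
  obtain ⟨a0, a1, a2⟩ := hP
  obtain ⟨b0, b1, b2⟩ := hQ
  fin_cases e
  · have := a0 rfl; have := b0 rfl; linarith
  · have := a1 rfl; have := b1 rfl; linarith
  · have := a2 rfl; have := b2 rfl; linarith

/-- A walk is determined by its positions after the openings and a bounded amount of data. -/
lemma card_le_of_openings_eq {k n : ℕ} {O : Finset ℕ} (S : Finset (Fin (k + 1) → Fin n))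
    (hS : ∀ p ∈ S, openings k (position p) = O) :
    S.card ≤ (3 * k) ^ k * (S.image (restrictTo (visits O))).card := by
  classical
  have hcode : ∀ (p : Fin (k + 1) → Fin n) (t : Fin k), ∃ c : Fin k × Fin 3,
      (t : ℕ) ∉ openings k (position p) →
        (c.1 : ℕ) < t ∧ Repeats (position p) t c.1 c.2 := by
    intro p t
    by_cases ht : (t : ℕ) ∈ openings k (position p)
    · exact ⟨⟨t, 0⟩, fun h => absurd ht h⟩
    · obtain ⟨s, hs, e, h⟩ := exists_repeats t.2 ht
      exact ⟨⟨⟨s, hs.trans t.2⟩, e⟩, fun _ => ⟨hs, h⟩⟩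
  choose code hcode using hcode
  have hcard : (Finset.univ : Finset (Fin k → Fin k × Fin 3)).card = (3 * k) ^ k := by
    rw [Finset.card_univ, Fintype.card_fun, Fintype.card_prod, Fintype.card_fin, Fintype.card_fin,
      mul_comm]
  rw [← hcard, ← Finset.card_product]
  refine Finset.card_le_card_of_injOn (fun p => (code p, restrictTo (visits O) p)) ?_ ?_
  · intro p hp
    exact Finset.mem_coe.2 (Finset.mem_product.2
      ⟨Finset.mem_univ _, Finset.mem_image_of_mem _ hp⟩)
  · intro p hp q hq hpq
    obtain ⟨h1, h2⟩ := Prod.mk.inj hpq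
    have hT : ∀ t ∈ visits O, position p t = position q t := fun t ht => by
      rw [← placement_restrictTo p ht, ← placement_restrictTo q ht, h2]
    have key : ∀ t ≤ k, ∀ r ≤ t, position p r = position q r := by
      intro t
      induction t with
      | zero =>
        intro _ r hr
        rw [Nat.le_zero.1 hr]
        exact hT 0 (zero_mem_visits O)
      | succ t ih =>
        intro htk r hr
        have ih := ih (by omega)
        rcases Nat.le_succ_iff.1 hr with hr | rfl
        · exact ih r hr
        · by_cases ht : t ∈ O
          · exact hT _ (succ_mem_visits.2 ht)
          · have hp' := hcode p ⟨t, htk⟩ (by rwa [hS p hp])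
            have hq' := hcode q ⟨t, htk⟩ (by rwa [hS q hq])
            rw [← h1] at hq'
            exact hp'.2.eq_of_eq hq'.2 hp'.1 ih
    exact eq_of_position_eq (key k le_rfl)

open scoped Classical in
/-- The closed matched walks of `k` steps. -/
noncomputable def matchedWalks (k n : ℕ) : Finset (Fin (k + 1) → Fin n) :=
  Finset.univ.filter fun p => p 0 = p (Fin.last k) ∧ WalkMatched k (position p)

lemma mem_matchedWalks {k n : ℕ} {p : Fin (k + 1) → Fin n} :
    p ∈ matchedWalks k n ↔ p 0 = p (Fin.last k) ∧ WalkMatched k (position p) := by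
  simp [matchedWalks]

/-- A walk has as many openings as possible and its positions after them are generic. -/
def IsTreeLike {k n : ℕ} (p : Fin (k + 1) → Fin n) : Prop :=
  2 * (openings k (position p)).card = k ∧
    Generic (visits (openings k (position p))) (position p)

open scoped Classical in
lemma exists_card_not_treeLike_le (k : ℕ) : ∃ C : ℕ, ∀ n, 0 < n →
    ((matchedWalks k n).filter fun p => ¬ IsTreeLike p).card ≤ C * n ^ ((k + 1) / 2) := by
  choose C hC using exists_card_nongeneric_le
  refine ⟨∑ O ∈ (Finset.range k).powerset, (3 * k) ^ k * (C (visits O) + 1), fun n hn => ?_⟩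
  set S := (matchedWalks k n).filter fun p => ¬ IsTreeLike p with hS
  have hmaps : ∀ p ∈ S, openings k (position p) ∈ (Finset.range k).powerset := fun p _ =>
    Finset.mem_powerset.2 (openings_subset_range k _)
  rw [Finset.card_eq_sum_card_fiberwise hmaps, Finset.sum_mul]
  refine Finset.sum_le_sum fun O _ => ?_
  set SO := S.filter fun p => openings k (position p) = O with hSO
  have hO : ∀ p ∈ SO, openings k (position p) = O := fun p hp => (Finset.mem_filter.1 hp).2
  refine (card_le_of_openings_eq SO hO).trans ?_
  rw [mul_assoc]
  refine Nat.mul_le_mul_left _ ?_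
  rcases SO.eq_empty_or_nonempty with hemp | ⟨p₀, hp₀⟩
  · simp [hemp]
  have hmatch : ∀ p ∈ SO, WalkMatched k (position p) ∧ ¬ IsTreeLike p := fun p hp => by
    have h := Finset.mem_filter.1 (Finset.mem_filter.1 hp).1
    exact ⟨(mem_matchedWalks.1 h.1).2, h.2⟩
  have hle := (hmatch p₀ hp₀).1.two_mul_card_openings_le
  rw [hO p₀ hp₀] at hle
  rcases hle.eq_or_lt with heq | hlt
  · have hsub : SO.image (restrictTo (visits O)) ⊆ nongeneric (visits O) n := by
      intro u hu
      obtain ⟨p, hp, rfl⟩ := Finset.mem_image.1 hu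
      rw [mem_nongeneric, generic_restrictTo_iff]
      intro hG
      refine (hmatch p hp).2 ?_
      rw [IsTreeLike, hO p hp]
      exact ⟨heq, hG⟩
    calc _ ≤ C (visits O) * n ^ ((visits O).card - 1) :=
          (Finset.card_le_card hsub).trans (hC _ n)
      _ = C (visits O) * n ^ ((k + 1) / 2) := by
          rw [card_visits]; congr 2; omega
      _ ≤ _ := Nat.mul_le_mul_right _ (Nat.le_succ _)
  · calc _ ≤ Fintype.card (visits O → Fin n) := Finset.card_le_univ _
      _ = n ^ (O.card + 1) := by
          rw [Fintype.card_fun, Fintype.card_fin, Fintype.card_coe, card_visits]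
      _ ≤ n ^ ((k + 1) / 2) := Nat.pow_le_pow_right hn (by omega)
      _ ≤ _ := Nat.le_mul_of_pos_left _ (Nat.succ_pos _)

lemma WalkMatched.openings_mem_dyckOpenings {k : ℕ} {P : ℕ → ℤ} (h : WalkMatched k P)
    (hk : 2 * (openings k P).card = k) (hG : Generic (visits (openings k P)) P) :
    openings k P ∈ dyckOpenings k :=
  mem_dyckOpenings.2 ⟨openings_subset_range k P, hk, fun t ht => (h.follows_stack hk hG t ht).1⟩

lemma firsts_congr {k : ℕ} {f g : ℕ → ℤ} (h : ∀ t < k, f t = g t) : firsts k f = firsts k g := by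
  ext t
  rw [mem_firsts, mem_firsts]
  refine and_congr_right fun ht => forall₂_congr fun s hs => ?_
  rw [h t ht, h s (hs.trans ht)]

lemma Matched.congr {k : ℕ} {f g : ℕ → ℤ} (hf : Matched k f) (h : ∀ t < k, f t = g t) :
    Matched k g := fun t ht => by
  obtain ⟨s, hs, hst, hfs⟩ := hf t ht
  exact ⟨s, hs, hst, by rw [← h s hs, ← h t ht, hfs]⟩

open scoped Classical in
/-- The tree-like matched walks with openings `O` correspond to generic placements. -/
lemma card_treeLike_openings {k n : ℕ} {O : Finset ℕ} (hO : O ∈ dyckOpenings k) :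
    ((matchedWalks k n).filter fun p => IsTreeLike p ∧ openings k (position p) = O).card =
      (Finset.univ.filter fun u : visits O → Fin n => Generic (visits O) (placement u)).card := by
  obtain ⟨hOk, hk, hne⟩ := mem_dyckOpenings.1 hO
  refine Finset.card_bij (fun p _ => restrictTo (visits O) p) ?_ ?_ ?_
  · intro p hp
    obtain ⟨-, ⟨-, hG⟩, hpO⟩ := Finset.mem_filter.1 hp
    rw [hpO] at hG
    exact Finset.mem_filter.2 ⟨Finset.mem_univ _, generic_restrictTo_iff.2 hG⟩
  · have key : ∀ p ∈ (matchedWalks k n).filter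
        (fun p => IsTreeLike p ∧ openings k (position p) = O),
        ∀ t ≤ k, position p t = placement (restrictTo (visits O) p) (top O t) := by
      intro p hp t ht
      obtain ⟨hp1, ⟨hp2, hG⟩, hpO⟩ := Finset.mem_filter.1 hp
      have := ((mem_matchedWalks.1 hp1).2.follows_stack hp2 hG t ht).2
      rw [hpO] at this
      rw [this, placement_restrictTo p (top_mem_visits O t)]
    intro p hp q hq hpq
    refine eq_of_position_eq fun t ht => ?_
    rw [key p hp t ht, key q hq t ht]
    exact congrArg (fun u => placement u (top O t)) hpq
  · intro u hu
    have hG := (Finset.mem_filter.1 hu).2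
    let p : Fin (k + 1) → Fin n := fun t => u ⟨top O t, top_mem_visits O t⟩
    have hp : ∀ t ≤ k, position p t = stackWalk O (placement u) t := by
      intro t ht
      have : ((Fin.ofNat (k + 1) t : Fin (k + 1)) : ℕ) = t := by
        simp [Fin.ofNat, Nat.mod_eq_of_lt (Nat.lt_succ_of_le ht)]
      rw [position, stackWalk, placement, dif_pos (top_mem_visits O t)]
      simp only [p, this]
    have hX : ∀ t < k, toeplitzIndex (position p) t = toeplitzIndex (stackWalk O (placement u)) t :=
      fun t ht => by rw [toeplitzIndex, toeplitzIndex, hp t ht.le, hp (t + 1) ht]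
    have hY : ∀ t < k, hankelIndex (position p) t = hankelIndex (stackWalk O (placement u)) t :=
      fun t ht => by rw [hankelIndex, hankelIndex, hp t ht.le, hp (t + 1) ht]
    have hmatch : WalkMatched k (position p) := by
      have := stackWalk_matched (u := placement u) hne hk hOk
      exact ⟨this.1.congr fun t ht => (hX t ht).symm, this.2.congr fun t ht => (hY t ht).symm⟩
    have hopen : openings k (position p) = O := by
      rw [← openings_stackWalk hne hOk hG, openings, openings, firsts_congr hX, firsts_congr hY]
    have hplace : ∀ t ∈ visits O, placement u t = position p t := by
      intro t ht
      have htk : t ≤ k := by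
        rcases t with _ | s
        · exact Nat.zero_le k
        · exact Finset.mem_range.1 (hOk (succ_mem_visits.1 ht))
      rw [hp t htk, stackWalk_of_mem _ ht]
    refine ⟨p, Finset.mem_filter.2 ⟨mem_matchedWalks.2 ⟨?_, hmatch⟩, ⟨?_, ?_⟩, hopen⟩, ?_⟩
    · have h := stackWalk_zero_eq (u := placement u) hne hk hOk
      have h0 := position_val p 0
      have h1 := position_val p (Fin.last k)
      rw [Fin.val_zero] at h0
      rw [Fin.val_last] at h1
      rw [← hp 0 (Nat.zero_le k), ← hp k le_rfl, h0, h1] at h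
      exact Fin.ext (by omega)
    · rw [hopen, hk]
    · rw [hopen]
      exact hG.congr hplace
    · funext t
      have h := hplace t t.2
      rw [← placement_restrictTo p t.2, placement, placement, dif_pos t.2, dif_pos t.2] at h
      exact Fin.ext (by simpa using h.symm)

open scoped Classical in
lemma exists_card_treeLike (k : ℕ) : ∃ C : ℕ, ∀ n,
    ((matchedWalks k n).filter IsTreeLike).card ≤ (dyckOpenings k).card * n ^ (k / 2 + 1) ∧
    (dyckOpenings k).card * n ^ (k / 2 + 1) ≤
      ((matchedWalks k n).filter IsTreeLike).card + C * n ^ (k / 2) := by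
  choose C hC using exists_card_nongeneric_le
  refine ⟨∑ O ∈ dyckOpenings k, C (visits O), fun n => ?_⟩
  have hmaps : ∀ p ∈ (matchedWalks k n).filter IsTreeLike,
      openings k (position p) ∈ dyckOpenings k := fun p hp => by
    obtain ⟨h1, h2, h3⟩ := Finset.mem_filter.1 hp
    exact (mem_matchedWalks.1 h1).2.openings_mem_dyckOpenings h2 h3
  have hsplit : ∀ O ∈ dyckOpenings k,
      (((matchedWalks k n).filter IsTreeLike).filter
        fun p => openings k (position p) = O).card + (nongeneric (visits O) n).card =
      n ^ (k / 2 + 1) := fun O hO => by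
    rw [Finset.filter_filter, card_treeLike_openings hO, nongeneric,
      Finset.card_filter_add_card_filter_not, Finset.card_univ, Fintype.card_fun,
      Fintype.card_fin, Fintype.card_coe, card_visits]
    congr 1
    have := (mem_dyckOpenings.1 hO).2.1
    omega
  have hbound : ∀ O ∈ dyckOpenings k,
      (nongeneric (visits O) n).card ≤ C (visits O) * n ^ (k / 2) := fun O hO => by
    refine (hC _ n).trans_eq ?_
    rw [card_visits]
    congr 2
    have := (mem_dyckOpenings.1 hO).2.1
    omega
  rw [Finset.card_eq_sum_card_fiberwise hmaps, Finset.sum_mul, ← smul_eq_mul,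
    ← Finset.sum_const, ← Finset.sum_add_distrib]
  constructor
  · exact Finset.sum_le_sum fun O hO => by have := hsplit O hO; omega
  · exact Finset.sum_le_sum fun O hO => by
      have := hsplit O hO
      have := hbound O hO
      omega

/-! ### Powers of matrices as sums over walks -/

lemma Matrix.pow_apply_eq_sum_walks {R : Type*} [CommSemiring R] {n : ℕ}
    (A : Matrix (Fin n) (Fin n) R) (k : ℕ) (i j : Fin n) :
    (A ^ k) i j = ∑ p : Fin (k + 1) → Fin n,
      if p 0 = i ∧ p (Fin.last k) = j then ∏ t : Fin k, A (p t.castSucc) (p t.succ) else 0 := by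
  induction k generalizing i with
  | zero =>
    rw [pow_zero, Matrix.one_apply, ← (Equiv.funUnique (Fin 1) (Fin n)).symm.sum_comp]
    by_cases h : i = j
    · subst h; simp [Fin.last]
    · have : ∀ x : Fin n, ¬ (x = i ∧ x = j) := fun x hx => h (hx.1.symm.trans hx.2)
      simp [Fin.last, h, this]
  | succ k ih =>
    rw [pow_succ', Matrix.mul_apply, ← (Fin.consEquiv fun _ => Fin n).sum_comp,
      Fintype.sum_prod_type]
    simp only [Fin.consEquiv_apply, Fin.cons_zero, ← Fin.succ_last, Fin.cons_succ,
      Fin.prod_univ_succ, Fin.castSucc_zero, ← Fin.succ_castSucc]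
    rw [Finset.sum_eq_single i (fun a _ ha => Finset.sum_eq_zero fun p _ => by simp [ha])
      (by simp)]
    simp_rw [ih, Finset.mul_sum]
    rw [Finset.sum_comm]
    refine Finset.sum_congr rfl fun p _ => ?_
    simp [ite_and]

section Trace

variable {Ω : Type*} {x y : ℤ → Ω → ℝ}

/-- The product of the variables along a walk. -/
def walkProduct (x y : ℤ → Ω → ℝ) (k : ℕ) (P : ℕ → ℤ) (ω : Ω) : ℝ :=
  (∏ t ∈ Finset.range k, x (toeplitzIndex P t) ω) * ∏ t ∈ Finset.range k, y (hankelIndex P t) ω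

lemma prod_scaledSchurProduct {k n : ℕ} (p : Fin (k + 1) → Fin n) (ω : Ω) :
    ∏ t : Fin k, scaledSchurProduct symmToeplitzLink hankelLink x y n ω (p t.castSucc) (p t.succ) =
      (Real.sqrt n)⁻¹ ^ k * walkProduct x y k (position p) ω := by
  rw [walkProduct, Finset.prod_range, Finset.prod_range, ← Finset.prod_mul_distrib]
  simp only [scaledSchurProduct, patternedMatrix, Matrix.smul_apply, Matrix.hadamard_apply,
    Matrix.of_apply, smul_eq_mul]
  rw [Finset.prod_mul_distrib, Finset.prod_const, Finset.card_univ, Fintype.card_fin]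
  congr 1
  refine Finset.prod_congr rfl fun t _ => ?_
  have h1 := position_val p t.castSucc
  have h2 := position_val p t.succ
  rw [Fin.val_castSucc] at h1
  rw [Fin.val_succ] at h2
  rw [toeplitzIndex, hankelIndex, h1, h2, symmToeplitzLink, hankelLink]
  push_cast
  rfl

lemma scaledSchurProduct_pow_apply {k n : ℕ} (ω : Ω) (i j : Fin n) :
    (scaledSchurProduct symmToeplitzLink hankelLink x y n ω ^ k) i j =
      ∑ p : Fin (k + 1) → Fin n, if p 0 = i ∧ p (Fin.last k) = j then
        (Real.sqrt n)⁻¹ ^ k * walkProduct x y k (position p) ω else 0 := by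
  rw [Matrix.pow_apply_eq_sum_walks]
  simp_rw [prod_scaledSchurProduct]

lemma trace_scaledSchurProduct_pow {k n : ℕ} (ω : Ω) :
    (scaledSchurProduct symmToeplitzLink hankelLink x y n ω ^ k).trace =
      (Real.sqrt n)⁻¹ ^ k * ∑ p : Fin (k + 1) → Fin n with p 0 = p (Fin.last k),
        walkProduct x y k (position p) ω := by
  simp only [Matrix.trace, Matrix.diag_apply, scaledSchurProduct_pow_apply]
  rw [Finset.sum_comm, Finset.mul_sum, Finset.sum_filter]
  refine Finset.sum_congr rfl fun p _ => ?_
  simp [ite_and, eq_comm]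

variable [MeasurableSpace Ω] {μ : Measure Ω} [IsProbabilityMeasure μ]

lemma integrable_walkProduct (hx : IsInputSequence μ x) (hy : IsInputSequence μ y)
    (hxy : IndepFun (fun (ω : Ω) (α : ℤ) => x α ω) (fun (ω : Ω) (α : ℤ) => y α ω) μ)
    (k : ℕ) (P : ℕ → ℤ) : Integrable (walkProduct x y k P) μ :=
  (indepFun_prod hxy k _ _).integrable_mul (hx.integrable_prod k _) (hy.integrable_prod k _)

lemma integral_walkProduct (hx : IsInputSequence μ x) (hy : IsInputSequence μ y)
    (hxy : IndepFun (fun (ω : Ω) (α : ℤ) => x α ω) (fun (ω : Ω) (α : ℤ) => y α ω) μ)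
    (k : ℕ) (P : ℕ → ℤ) : ∫ ω, walkProduct x y k P ω ∂μ =
      (∫ ω, ∏ t ∈ Finset.range k, x (toeplitzIndex P t) ω ∂μ) *
        ∫ ω, ∏ t ∈ Finset.range k, y (hankelIndex P t) ω ∂μ :=
  (indepFun_prod hxy k _ _).integral_fun_mul_eq_mul_integral
    (hx.integrable_prod k _).aestronglyMeasurable (hy.integrable_prod k _).aestronglyMeasurable

lemma integrable_scaledSchurProduct_pow (hx : IsInputSequence μ x) (hy : IsInputSequence μ y)
    (hxy : IndepFun (fun (ω : Ω) (α : ℤ) => x α ω) (fun (ω : Ω) (α : ℤ) => y α ω) μ)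
    (k n : ℕ) (i j : Fin n) : Integrable
      (fun ω => (scaledSchurProduct symmToeplitzLink hankelLink x y n ω ^ k) i j) μ := by
  simp_rw [scaledSchurProduct_pow_apply]
  refine integrable_finsetSum _ fun p _ => ?_
  split_ifs
  · exact (integrable_walkProduct hx hy hxy k _).const_mul _
  · exact integrable_zero _ _ _

lemma integral_walkProduct_eq_zero (hx : IsInputSequence μ x) (hy : IsInputSequence μ y)
    (hxy : IndepFun (fun (ω : Ω) (α : ℤ) => x α ω) (fun (ω : Ω) (α : ℤ) => y α ω) μ)
    {k : ℕ} {P : ℕ → ℤ} (h : ¬ WalkMatched k P) : ∫ ω, walkProduct x y k P ω ∂μ = 0 := by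
  rw [integral_walkProduct hx hy hxy]
  rcases not_and_or.1 h with h | h
  · rw [hx.integral_prod_eq_zero h, zero_mul]
  · rw [hy.integral_prod_eq_zero h, mul_zero]

lemma integral_walkProduct_eq_one (hx : IsInputSequence μ x) (hy : IsInputSequence μ y)
    (hxy : IndepFun (fun (ω : Ω) (α : ℤ) => x α ω) (fun (ω : Ω) (α : ℤ) => y α ω) μ)
    {k : ℕ} {P : ℕ → ℤ} (h : WalkMatched k P) (hk : 2 * (openings k P).card = k) :
    ∫ ω, walkProduct x y k P ω ∂μ = 1 := by
  rw [integral_walkProduct hx hy hxy, hx.integral_prod_eq_one h.1, hy.integral_prod_eq_one h.2,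
    one_mul]
  · rw [h.firsts_hankelIndex hk, hk]
  · rw [h.firsts_toeplitzIndex hk, hk]

lemma exists_abs_integral_walkProduct_le (hx : IsInputSequence μ x) (hy : IsInputSequence μ y)
    (hxy : IndepFun (fun (ω : Ω) (α : ℤ) => x α ω) (fun (ω : Ω) (α : ℤ) => y α ω) μ) (k : ℕ) :
    ∃ C : ℝ, 0 ≤ C ∧ ∀ P, |∫ ω, walkProduct x y k P ω ∂μ| ≤ C := by
  obtain ⟨A, hA⟩ := hx.exists_abs_integral_prod_le k
  obtain ⟨B, hB⟩ := hy.exists_abs_integral_prod_le k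
  have hA0 : 0 ≤ A := (abs_nonneg _).trans (hA fun _ => 0)
  have hB0 : 0 ≤ B := (abs_nonneg _).trans (hB fun _ => 0)
  refine ⟨A * B, mul_nonneg hA0 hB0, fun P => ?_⟩
  rw [integral_walkProduct hx hy hxy, abs_mul]
  exact mul_le_mul (hA _) (hB _) (abs_nonneg _) hA0

open scoped Classical in
lemma integral_trace_scaledSchurProduct_pow (hx : IsInputSequence μ x) (hy : IsInputSequence μ y)
    (hxy : IndepFun (fun (ω : Ω) (α : ℤ) => x α ω) (fun (ω : Ω) (α : ℤ) => y α ω) μ) (k n : ℕ) :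
    ∫ ω, (scaledSchurProduct symmToeplitzLink hankelLink x y n ω ^ k).trace ∂μ =
      (Real.sqrt n)⁻¹ ^ k * (((matchedWalks k n).filter IsTreeLike).card +
        ∑ p ∈ (matchedWalks k n).filter fun p => ¬ IsTreeLike p,
          ∫ ω, walkProduct x y k (position p) ω ∂μ) := by
  simp_rw [trace_scaledSchurProduct_pow]
  rw [integral_const_mul,
    integral_finsetSum _ fun p _ => integrable_walkProduct hx hy hxy k (position p)]
  congr 1
  have h1 : ∑ p ∈ (matchedWalks k n).filter IsTreeLike,
      ∫ ω, walkProduct x y k (position p) ω ∂μ = ((matchedWalks k n).filter IsTreeLike).card := by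
    rw [Finset.sum_congr rfl (g := fun _ => (1 : ℝ)) fun p hp => ?_]
    · simp
    · obtain ⟨h1, h2, -⟩ := Finset.mem_filter.1 hp
      exact integral_walkProduct_eq_one hx hy hxy (mem_matchedWalks.1 h1).2 h2
  rw [← h1, Finset.sum_filter_add_sum_filter_not]
  symm
  refine Finset.sum_subset (fun p hp => ?_) fun p hp hp' => ?_
  · simpa using (mem_matchedWalks.1 hp).1
  · refine integral_walkProduct_eq_zero hx hy hxy fun h => hp' ?_
    exact mem_matchedWalks.2 ⟨by simpa using hp, h⟩

end Trace

lemma exists_abs_expectedNormalizedTrace_sub_le {Ω : Type*} [MeasurableSpace Ω] {μ : Measure Ω}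
    [IsProbabilityMeasure μ] {x y : ℤ → Ω → ℝ} (hx : IsInputSequence μ x)
    (hy : IsInputSequence μ y)
    (hxy : IndepFun (fun (ω : Ω) (α : ℤ) => x α ω) (fun (ω : Ω) (α : ℤ) => y α ω) μ) (k : ℕ) :
    ∃ C : ℝ, ∀ n : ℕ, 0 < n → |expectedNormalizedTrace μ
        (fun ω => scaledSchurProduct symmToeplitzLink hankelLink x y n ω ^ k) -
          semicircularMoment k| ≤ C * (Real.sqrt n)⁻¹ := by
  classical
  obtain ⟨C₁, hC₁⟩ := exists_card_treeLike k
  obtain ⟨C₂, hC₂⟩ := exists_card_not_treeLike_le k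
  obtain ⟨C₃, hC₃, hbound⟩ := exists_abs_integral_walkProduct_le hx hy hxy k
  refine ⟨C₁ + C₂ * C₃, fun n hn => ?_⟩
  rw [expectedNormalizedTrace, integral_trace_scaledSchurProduct_pow hx hy hxy,
    ← card_dyckOpenings]
  set a : ℝ := (((matchedWalks k n).filter IsTreeLike).card : ℝ) with ha
  set b : ℝ := ∑ p ∈ (matchedWalks k n).filter fun p => ¬ IsTreeLike p,
    ∫ ω, walkProduct x y k (position p) ω ∂μ with hb
  set D : ℝ := ((dyckOpenings k).card : ℝ) with hD
  set r : ℝ := Real.sqrt n with hr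
  have hn1 : (1 : ℝ) ≤ n := by exact_mod_cast hn
  have hr1 : 1 ≤ r := Real.one_le_sqrt.2 hn1
  have hr0 : 0 < r := by linarith
  have hrn : (n : ℝ) = r ^ 2 := (Real.sq_sqrt (Nat.cast_nonneg n)).symm
  have hpow : ∀ j, 2 * j ≤ k + 1 → (n : ℝ) ^ j ≤ r ^ (k + 1) := fun j hj => by
    rw [hrn, ← pow_mul]
    exact pow_le_pow_right₀ hr1 hj
  have hDr : D * (n : ℝ) ^ (k / 2 + 1) = D * r ^ (k + 2) := by
    by_cases hk : Even k
    · rw [hrn, ← pow_mul]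
      congr 2
      have := Nat.even_iff.1 hk
      omega
    · simp [hD, dyckOpenings_of_odd hk]
  have hab : |a - D * r ^ (k + 2)| ≤ C₁ * r ^ (k + 1) := by
    have h1 : a ≤ D * (n : ℝ) ^ (k / 2 + 1) := by
      rw [ha, hD]
      exact_mod_cast (hC₁ n).1
    have h2 : D * (n : ℝ) ^ (k / 2 + 1) ≤ a + C₁ * (n : ℝ) ^ (k / 2) := by
      rw [ha, hD]
      exact_mod_cast (hC₁ n).2
    have h3 : (C₁ : ℝ) * (n : ℝ) ^ (k / 2) ≤ C₁ * r ^ (k + 1) :=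
      mul_le_mul_of_nonneg_left (hpow _ (by omega)) (Nat.cast_nonneg _)
    rw [hDr] at h1 h2
    rw [abs_le]
    constructor <;> linarith
  have hbb : |b| ≤ C₂ * C₃ * r ^ (k + 1) := by
    calc |b| ≤ ∑ p ∈ (matchedWalks k n).filter fun p => ¬ IsTreeLike p, C₃ :=
          (Finset.abs_sum_le_sum_abs _ _).trans (Finset.sum_le_sum fun p _ => hbound _)
      _ = ((matchedWalks k n).filter fun p => ¬ IsTreeLike p).card * C₃ := by simp
      _ ≤ (C₂ * (n : ℝ) ^ ((k + 1) / 2)) * C₃ := by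
          refine mul_le_mul_of_nonneg_right ?_ hC₃
          exact_mod_cast hC₂ n hn
      _ ≤ (C₂ * r ^ (k + 1)) * C₃ := by
          refine mul_le_mul_of_nonneg_right ?_ hC₃
          exact mul_le_mul_of_nonneg_left (hpow _ (by omega)) (Nat.cast_nonneg _)
      _ = _ := by ring
  have heq : 1 / (n : ℝ) * (r⁻¹ ^ k * (a + b)) - D =
      ((a - D * r ^ (k + 2)) + b) / r ^ (k + 2) := by
    rw [hrn, inv_pow]
    field_simp
    ring
  rw [heq, abs_div, abs_of_pos (pow_pos hr0 _), div_le_iff₀ (pow_pos hr0 _)]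
  calc |a - D * r ^ (k + 2) + b| ≤ |a - D * r ^ (k + 2)| + |b| := abs_add_le _ _
    _ ≤ C₁ * r ^ (k + 1) + C₂ * C₃ * r ^ (k + 1) := add_le_add hab hbb
    _ = (C₁ + C₂ * C₃) * r⁻¹ * r ^ (k + 2) := by
        field_simp
        ring

theorem mainTheorem5 {Ω : Type*} [MeasurableSpace Ω] (μ : Measure Ω) [IsProbabilityMeasure μ]
    (x y : ℤ → Ω → ℝ) (hx : IsInputSequence μ x) (hy : IsInputSequence μ y)
    (hxy : IndepFun (fun (ω : Ω) (α : ℤ) => x α ω) (fun (ω : Ω) (α : ℤ) => y α ω) μ)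
    (k : ℕ) :
    (∀ n : ℕ, ∀ i j : Fin n, Integrable
      (fun ω => (scaledSchurProduct symmToeplitzLink hankelLink x y n ω ^ k) i j) μ) ∧
    Tendsto
      (fun n : ℕ => expectedNormalizedTrace μ
        (fun ω => scaledSchurProduct symmToeplitzLink hankelLink x y n ω ^ k))
      atTop (𝓝 (semicircularMoment k)) := by
  refine ⟨fun n i j => integrable_scaledSchurProduct_pow hx hy hxy k n i j, ?_⟩
  obtain ⟨C, hC⟩ := exists_abs_expectedNormalizedTrace_sub_le hx hy hxy k
  rw [tendsto_iff_norm_sub_tendsto_zero]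
  have hlim : Tendsto (fun n : ℕ => C * (Real.sqrt n)⁻¹) atTop (𝓝 0) := by
    have h := (tendsto_inv_atTop_zero.comp
      (Real.tendsto_sqrt_atTop.comp tendsto_natCast_atTop_atTop)).const_mul C
    simpa using h
  refine squeeze_zero' (Eventually.of_forall fun _ => norm_nonneg _) ?_ hlim
  filter_upwards [eventually_gt_atTop 0] with n hn
  exact hC n hn
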